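/- Let $G$ be a discrete group. Let $\ell^1(G)$ be the Banach $*$-algebra of absolutely summable functions $f:G\to\mathbb C$ with the norm $\|f\|_1=\sum_{x\in G}|f(x)|$, the convolution $(f*g)(x)=\sum_{y\in G}f(y)g(y^{-1}x)$ and the involution $f^*(x)=\overline{f(x^{-1})}$. Call $G$ quasi-Hermitian if, for every finitely supported $f:G\to\mathbb C$ with $f=f^*$, the spectrum of $f$ in $\ell^1(G)$ is contained in $\mathbb R$. Call $G$ amenable if there is a left $G$-invariant state on $\ell^\infty(G)$, that is, a positive linear functional $m:\ell^\infty(G)\to\mathbb C$ with $m(1)=1$ and $m(\lambda_x\varphi)=m(\varphi)$ for all $x\in G$ and $\varphi\in\ell^\infty(G)$, where $(\lambda_x\varphi)(y)=\varphi(x^{-1}y)$. If $G$ is quasi-Hermitian, then $G$ is amenable. -/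

import Mathlib

open scoped ENNReal

noncomputable section

/-- The Banach space `ℓ¹(G)` of absolutely summable complex functions on `G`. It is a type of its
own, because the involution of the group algebra is not the pointwise one carried by `lp`. -/
def GroupL1 (G : Type*) : Type _ := lp (fun _ : G => ℂ) 1

namespace GroupL1

variable {G : Type*}

instance : NormedAddCommGroup (GroupL1 G) :=
  inferInstanceAs (NormedAddCommGroup (lp (fun _ : G => ℂ) 1))

instance : NormedSpace ℂ (GroupL1 G) :=
  inferInstanceAs (NormedSpace ℂ (lp (fun _ : G => ℂ) 1))

instance : CompleteSpace (GroupL1 G) :=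
  inferInstanceAs (CompleteSpace (lp (fun _ : G => ℂ) 1))

instance : FunLike (GroupL1 G) G ℂ where
  coe f := f.1
  coe_injective _ _ h := Subtype.ext h

@[ext] theorem ext {f g : GroupL1 G} (h : ∀ x, f x = g x) : f = g := DFunLike.ext f g h

@[simp] theorem add_apply (f g : GroupL1 G) (x : G) : (f + g) x = f x + g x := rfl

@[simp] theorem zero_apply (x : G) : (0 : GroupL1 G) x = 0 := rfl

@[simp] theorem smul_apply (c : ℂ) (f : GroupL1 G) (x : G) : (c • f) x = c * f x := rfl

theorem summable_norm (f : GroupL1 G) : Summable fun x => ‖f x‖ := by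
  have h := (lp.memℓp (p := 1) f).summable (by simp)
  simp only [ENNReal.toReal_one, Real.rpow_one] at h
  exact h

theorem norm_def (f : GroupL1 G) : ‖f‖ = ∑' x, ‖f x‖ := by
  have h := lp.norm_eq_tsum_rpow (p := 1) (by simp) (f : lp (fun _ : G => ℂ) 1)
  simp only [ENNReal.toReal_one, Real.rpow_one, div_one] at h
  exact h

theorem norm_apply_le (f : GroupL1 G) (x : G) : ‖f x‖ ≤ ‖f‖ :=
  lp.norm_apply_le_norm (p := 1) one_ne_zero (f : lp (fun _ : G => ℂ) 1) x

/-- An absolutely summable function as an element of `ℓ¹(G)`. -/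
def mk (f : G → ℂ) (hf : Summable fun x => ‖f x‖) : GroupL1 G :=
  ⟨f, memℓp_gen (by simpa using hf)⟩

@[simp] theorem mk_apply (f : G → ℂ) (hf : Summable fun x => ‖f x‖) (x : G) : mk f hf x = f x := rfl

variable [Group G]

theorem summable_norm_conv (f g : GroupL1 G) :
    Summable fun p : G × G => ‖f p.1 * g (p.1⁻¹ * p.2)‖ :=
  (Equiv.summable_iff (Equiv.prodShear (Equiv.refl G) (fun y : G => Equiv.mulLeft y⁻¹))).2
    (f.summable_norm.mul_norm g.summable_norm)

theorem summable_norm_conv_swap (f g : GroupL1 G) :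
    Summable fun p : G × G => ‖f p.2 * g (p.2⁻¹ * p.1)‖ :=
  (summable_norm_conv f g).prod_symm

theorem summable_norm_conv_apply (f g : GroupL1 G) (x : G) :
    Summable fun y => ‖f y * g (y⁻¹ * x)‖ :=
  (summable_norm_conv_swap f g).prod_factor x

theorem summable_conv_apply (f g : GroupL1 G) (x : G) :
    Summable fun y => f y * g (y⁻¹ * x) :=
  (summable_norm_conv_apply f g x).of_norm

theorem norm_conv_le (f g : GroupL1 G) (x : G) :
    ‖∑' y, f y * g (y⁻¹ * x)‖ ≤ ∑' y, ‖f y * g (y⁻¹ * x)‖ :=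
  norm_tsum_le_tsum_norm (summable_norm_conv_apply f g x)

/-- Convolution: `(f * g) x = ∑ y, f y * g (y⁻¹ * x)`. -/
instance : Mul (GroupL1 G) where
  mul f g := mk (fun x => ∑' y, f y * g (y⁻¹ * x))
    ((summable_norm_conv_swap f g).prod.of_nonneg_of_le (fun _ => norm_nonneg _) (norm_conv_le f g))

theorem mul_apply (f g : GroupL1 G) (x : G) : (f * g) x = ∑' y, f y * g (y⁻¹ * x) := rfl

/-- The unit is the point mass at the identity of `G`. -/
instance : One (GroupL1 G) where
  one := mk (Set.indicator {1} fun _ => 1) (summable_of_hasFiniteSupport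
    ((Set.finite_singleton (1 : G)).subset fun x hx => by
      by_contra h
      exact hx (by simp [Set.indicator_of_notMem h])))

theorem one_apply_one : (1 : GroupL1 G) 1 = 1 :=
  Set.indicator_of_mem (Set.mem_singleton (1 : G)) fun _ => (1 : ℂ)

theorem one_apply_of_ne {x : G} (hx : x ≠ 1) : (1 : GroupL1 G) x = 0 :=
  Set.indicator_of_notMem (s := {(1 : G)}) hx fun _ => (1 : ℂ)

protected theorem one_mul' (f : GroupL1 G) : 1 * f = f := by
  ext x
  rw [mul_apply, tsum_eq_single 1 fun y hy => by rw [one_apply_of_ne hy, zero_mul]]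
  simp [one_apply_one]

protected theorem mul_one' (f : GroupL1 G) : f * 1 = f := by
  ext x
  rw [mul_apply, tsum_eq_single x fun y hy => by
    rw [one_apply_of_ne, mul_zero]
    intro h
    exact hy (inv_mul_eq_one.1 h)]
  simp [one_apply_one]

protected theorem mul_assoc' (f g h : GroupL1 G) : f * g * h = f * (g * h) := by
  ext x
  have key : Summable fun p : G × G => f p.2 * g (p.2⁻¹ * p.1) * h (p.1⁻¹ * x) := by
    refine Summable.of_norm_bounded ((summable_norm_conv_swap f g).mul_right ‖h‖) fun p => ?_
    rw [norm_mul]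
    exact mul_le_mul_of_nonneg_left (norm_apply_le h _) (norm_nonneg _)
  calc (f * g * h) x = ∑' z, ∑' y, f y * g (y⁻¹ * z) * h (z⁻¹ * x) := by
        simp only [mul_apply, tsum_mul_right]
    _ = ∑' y, ∑' z, f y * g (y⁻¹ * z) * h (z⁻¹ * x) :=
        Summable.tsum_comm (f := fun y z => f y * g (y⁻¹ * z) * h (z⁻¹ * x)) key.prod_symm
    _ = (f * (g * h)) x := by
        simp only [mul_apply, mul_assoc, tsum_mul_left]
        refine tsum_congr fun y => ?_
        congr 1
        rw [← (Equiv.mulLeft y).tsum_eq]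
        simp [mul_assoc]

instance : Ring (GroupL1 G) where
  __ := (inferInstance : AddCommGroup (GroupL1 G))
  mul_assoc := GroupL1.mul_assoc'
  one_mul := GroupL1.one_mul'
  mul_one := GroupL1.mul_one'
  zero_mul f := by ext x; simp [mul_apply]
  mul_zero f := by ext x; simp [mul_apply]
  left_distrib f g h := by
    ext x
    simp only [mul_apply, add_apply, mul_add]
    exact (summable_conv_apply f g x).tsum_add (summable_conv_apply f h x)
  right_distrib f g h := by
    ext x
    simp only [mul_apply, add_apply, add_mul]
    exact (summable_conv_apply f h x).tsum_add (summable_conv_apply g h x)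

instance : NormedRing (GroupL1 G) where
  __ := (inferInstance : NormedAddCommGroup (GroupL1 G))
  __ := (inferInstance : Ring (GroupL1 G))
  norm_mul_le f g := by
    calc ‖f * g‖ = ∑' x, ‖∑' y, f y * g (y⁻¹ * x)‖ := norm_def _
      _ ≤ ∑' x, ∑' y, ‖f y * g (y⁻¹ * x)‖ :=
          (f * g).summable_norm.tsum_le_tsum (norm_conv_le f g) (summable_norm_conv_swap f g).prod
      _ = ∑' y, ∑' x, ‖f y * g (y⁻¹ * x)‖ :=
          Summable.tsum_comm (f := fun y x => ‖f y * g (y⁻¹ * x)‖) (summable_norm_conv f g)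
      _ = ‖f‖ * ‖g‖ := by
          rw [norm_def f, ← tsum_mul_right]
          refine tsum_congr fun y => ?_
          simp only [norm_mul, tsum_mul_left]
          rw [norm_def g, ← (Equiv.mulLeft y⁻¹).tsum_eq (fun x => ‖g x‖)]
          rfl

instance : Algebra ℂ (GroupL1 G) :=
  Algebra.ofModule
    (fun c f g => by
      ext x
      simp only [mul_apply, smul_apply, mul_assoc, tsum_mul_left])
    (fun c f g => by
      ext x
      simp only [mul_apply, smul_apply, mul_left_comm _ c, tsum_mul_left])

instance : NormedAlgebra ℂ (GroupL1 G) where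
  norm_smul_le := norm_smul_le

/-- The involution of the group algebra: `f* x` is the complex conjugate of `f (x⁻¹)`. -/
instance : Star (GroupL1 G) where
  star f := mk (fun x => star (f x⁻¹)) (by
    simpa [Function.comp_def] using (Equiv.inv G).summable_iff.2 f.summable_norm)

theorem star_apply (f : GroupL1 G) (x : G) : (star f) x = star (f x⁻¹) := rfl

instance : StarRing (GroupL1 G) where
  star_involutive f := by ext x; simp [star_apply]
  star_mul f g := by
    ext x
    simp only [star_apply, mul_apply, tsum_star, star_mul]
    rw [← (Equiv.mulLeft x⁻¹).tsum_eq]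
    simp
  star_add f g := by ext x; simp [star_apply]

instance : StarModule ℂ (GroupL1 G) where
  star_smul c f := by ext x; simp [star_apply]

instance : NormedStarGroup (GroupL1 G) where
  norm_star_le f := by
    rw [norm_def, norm_def, ← (Equiv.inv G).tsum_eq (fun x => ‖f x‖)]
    simp [star_apply]

end GroupL1

/-- A discrete group `G` is quasi-Hermitian if every self-adjoint, finitely supported `f : G → ℂ`
has real spectrum in the Banach `*`-algebra `ℓ¹(G)`. -/
def IsQuasiHermitianGroup (G : Type*) [Group G] : Prop :=
  ∀ f : GroupL1 G, (Function.support (f : G → ℂ)).Finite → IsSelfAdjoint f →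
    ∀ z ∈ spectrum ℂ f, z.im = 0

/-- The left translate `y ↦ φ (x⁻¹ * y)` of a bounded function on `G`. -/
def leftTranslate {G : Type*} [Group G] (x : G) (φ : lp (fun _ : G => ℂ) ∞) :
    lp (fun _ : G => ℂ) ∞ :=
  ⟨fun y => φ (x⁻¹ * y), memℓp_infty (by
    refine (lp.memℓp φ).bddAbove.mono ?_
    rintro _ ⟨y, rfl⟩
    exact ⟨x⁻¹ * y, rfl⟩)⟩

open scoped ComplexOrder in
/-- A discrete group `G` is amenable if there is a left invariant state on `ℓ^∞(G)`: a positive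
unital linear functional that does not change under left translation. -/
def IsAmenableGroup (G : Type*) [Group G] : Prop :=
  ∃ m : lp (fun _ : G => ℂ) ∞ →L[ℂ] ℂ,
    (∀ φ : lp (fun _ : G => ℂ) ∞, (∀ y, 0 ≤ φ y) → 0 ≤ m φ) ∧ m 1 = 1 ∧
    ∀ (x : G) (φ : lp (fun _ : G => ℂ) ∞), m (leftTranslate x φ) = m φ

end

open scoped ENNReal NNReal Pointwise
open Filter Topology Polynomial

/-! Let `f` be the uniform measure on a finite symmetric set `S`, and let `r` be the norm of
convolution by `f` on `ℓ²(G)`. The core is Kesten's condition `1 ≤ r`, obtained by interpolating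
between `ℓ¹` and `ℓ²`. For `0 < θ ≤ 1` let `N_θ` be the real interpolation seminorm with parameters
`(θ, ∞)`; for small `θ` it is close to the `ℓ¹` end.

Upper bound (`eventually_interpolation_pow_mul_le`): the spectrum of `f` in `ℓ¹(G)` lies in `[-1,
1]`, by the quasi-Hermitian hypothesis. A real polynomial `Q` that is bounded by `2` there and by
`ε` on `[-r, r]` gives `‖Q(f)^n‖ ≤ 3^n` on `ℓ¹` for some `n > 0`, and at most `ε^n` on `ℓ²` by the
functional calculus of a self-adjoint operator. By interpolation `Q(f)` has spectral radius at most
`3 * ε^θ` for `N_θ`. A spectral value of `f` outside `[-r, r]`, at which `Q` stays large, is thus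
impossible, and `f` has spectral radius at most `r` for every `N_θ`, however small `θ` is.

Lower bound (`rpow_le_interpolation`): `f^n` has sum one and lives on at most `|S|^n` points, so
`N_θ(f^n) ≥ |S|^(-nθ/2)`. Hence `|S|^(-θ/2) ≤ R` for all `R > r`, and `θ → 0` gives `1 ≤ r`.

Kesten's condition yields almost invariant unit vectors in `ℓ²(G)` by the parallelogram law, and a
weak-* limit of their vector states is an invariant state. -/

noncomputable section

/-! ### The inclusion of `ℓ¹` in `ℓ²`. -/

namespace GroupL1

variable {G : Type*}

/-- The inclusion of `ℓ¹(G)` in `ℓ²(G)`. -/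
def toL2 : GroupL1 G →ₗ[ℂ] lp (fun _ : G => ℂ) 2 where
  toFun f := ⟨f.1, (lp.memℓp (p := 1) f).of_exponent_ge one_le_two⟩
  map_add' _ _ := rfl
  map_smul' _ _ := rfl

@[simp] theorem toL2_apply (f : GroupL1 G) (x : G) : toL2 f x = f x := rfl

theorem norm_toL2_le (f : GroupL1 G) : ‖toL2 f‖ ≤ ‖f‖ := by
  refine lp.norm_le_of_forall_sum_le (by simp) (norm_nonneg _) fun s => ?_
  simp only [toL2_apply, ENNReal.toReal_ofNat, Real.rpow_ofNat]
  calc ∑ i ∈ s, ‖f i‖ ^ 2 ≤ ∑ i ∈ s, ‖f i‖ * ‖f‖ := by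
        refine Finset.sum_le_sum fun i _ => ?_
        rw [sq]
        exact mul_le_mul_of_nonneg_left (norm_apply_le f i) (norm_nonneg _)
    _ = (∑ i ∈ s, ‖f i‖) * ‖f‖ := by rw [Finset.sum_mul]
    _ ≤ ‖f‖ * ‖f‖ := by
        refine mul_le_mul_of_nonneg_right ?_ (norm_nonneg _)
        rw [norm_def]
        exact f.summable_norm.sum_le_tsum s fun _ _ => norm_nonneg _
    _ = ‖f‖ ^ 2 := (sq _).symm

end GroupL1

/-! ### The left regular representation and convolution operators. -/

section LeftRegular

variable {G : Type*} [Group G]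

/-- The left regular representation of `G` on `ℓ²(G)`. -/
def leftRegular (s : G) : lp (fun _ : G => ℂ) 2 →ₗᵢ[ℂ] lp (fun _ : G => ℂ) 2 where
  toFun ξ := ⟨fun x => ξ (s⁻¹ * x), memℓp_gen
    ((Equiv.mulLeft s⁻¹).summable_iff.2 ((lp.memℓp ξ).summable (by simp)))⟩
  map_add' _ _ := rfl
  map_smul' _ _ := rfl
  norm_map' ξ := by
    rw [lp.norm_eq_tsum_rpow (by simp), lp.norm_eq_tsum_rpow (by simp)]
    congr 1
    exact (Equiv.mulLeft s⁻¹).tsum_eq fun x => ‖ξ x‖ ^ (2 : ℝ≥0∞).toReal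

@[simp] theorem leftRegular_apply (s : G) (ξ : lp (fun _ : G => ℂ) 2) (x : G) :
    leftRegular s ξ x = ξ (s⁻¹ * x) := rfl

@[simp] theorem leftRegular_one (ξ : lp (fun _ : G => ℂ) 2) : leftRegular (1 : G) ξ = ξ := by
  ext x; simp

theorem leftRegular_inv_leftRegular (s : G) (ξ : lp (fun _ : G => ℂ) 2) :
    leftRegular s⁻¹ (leftRegular s ξ) = ξ := by
  ext x; simp

theorem norm_leftRegular_le (s : G) :
    ‖(leftRegular s).toContinuousLinearMap‖ ≤ 1 :=
  (leftRegular s).norm_toContinuousLinearMap_le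

theorem inner_leftRegular_left (s : G) (ξ η : lp (fun _ : G => ℂ) 2) :
    inner ℂ (leftRegular s ξ) η = inner ℂ ξ (leftRegular s⁻¹ η) := by
  rw [← (leftRegular s⁻¹).inner_map_map, leftRegular_inv_leftRegular]

theorem star_leftRegular (s : G) :
    star (leftRegular s).toContinuousLinearMap = (leftRegular s⁻¹).toContinuousLinearMap := by
  rw [ContinuousLinearMap.star_eq_adjoint, eq_comm, ContinuousLinearMap.eq_adjoint_iff]
  intro ξ η
  simp [inner_leftRegular_left]

namespace GroupL1

theorem summable_norm_smul_leftRegular (g : GroupL1 G) :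
    Summable fun s => ‖g s • (leftRegular s).toContinuousLinearMap‖ := by
  refine g.summable_norm.of_nonneg_of_le (fun _ => norm_nonneg _) fun s => ?_
  rw [norm_smul]
  exact mul_le_of_le_one_right (norm_nonneg _) (norm_leftRegular_le s)

/-- The operator of convolution by `g` on `ℓ²(G)`. -/
def convL2 (g : GroupL1 G) : lp (fun _ : G => ℂ) 2 →L[ℂ] lp (fun _ : G => ℂ) 2 :=
  ∑' s, g s • (leftRegular s).toContinuousLinearMap

theorem norm_convL2_le (g : GroupL1 G) : ‖convL2 g‖ ≤ ‖g‖ := by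
  rw [norm_def]
  refine (norm_tsum_le_tsum_norm (summable_norm_smul_leftRegular g)).trans
    ((summable_norm_smul_leftRegular g).tsum_le_tsum (fun s => ?_) g.summable_norm)
  rw [norm_smul]
  exact mul_le_of_le_one_right (norm_nonneg _) (norm_leftRegular_le s)

theorem hasSum_convL2 (g : GroupL1 G) (ξ : lp (fun _ : G => ℂ) 2) :
    HasSum (fun s => g s • leftRegular s ξ) (convL2 g ξ) := by
  have h : HasSum (fun s => g s • (leftRegular s).toContinuousLinearMap) (convL2 g) :=
    (summable_norm_smul_leftRegular g).of_norm.hasSum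
  exact h.mapL (ContinuousLinearMap.apply ℂ (lp (fun _ : G => ℂ) 2) ξ)

theorem convL2_apply (g : GroupL1 G) (ξ : lp (fun _ : G => ℂ) 2) (x : G) :
    convL2 g ξ x = ∑' s, g s * ξ (s⁻¹ * x) :=
  (((lp.evalCLM ℂ (fun _ : G => ℂ) 2 x).hasSum (hasSum_convL2 g ξ)).tsum_eq).symm

theorem convL2_toL2 (g f : GroupL1 G) : convL2 g (toL2 f) = toL2 (g * f) := by
  ext x
  rw [convL2_apply, toL2_apply, mul_apply]
  rfl

/-- Translation by `s` is unitary with adjoint translation by `s⁻¹`, so reindexing the adjoint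
series by inversion replaces `g` by `star g`. -/
theorem isSelfAdjoint_convL2 {g : GroupL1 G} (hg : IsSelfAdjoint g) :
    IsSelfAdjoint (convL2 g) := by
  rw [isSelfAdjoint_iff, convL2, tsum_star, ← (Equiv.inv G).tsum_eq]
  refine tsum_congr fun s => ?_
  rw [star_smul, star_leftRegular, Equiv.inv_apply, inv_inv, ← star_apply, hg.star_eq]

end GroupL1

end LeftRegular

/-! ### Real interpolation of seminorms. -/

namespace Seminorm

variable {E : Type*} [AddCommGroup E] [Module ℂ E]

/-- The real interpolation seminorm with parameters `(θ, ∞)` between `p` and `q`. -/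
def interpolation (p q : Seminorm ℂ E) (θ : ℝ) : Seminorm ℂ E :=
  ⨆ t : {t : ℝ≥0 // 0 < t}, ((t : ℝ≥0) ^ (-θ)) • (p ⊓ (t : ℝ≥0) • q)

variable {p q : Seminorm ℂ E} {θ : ℝ}

/-- The infimum of two seminorms is their infimal convolution, so `p ⊓ t • q` is Peetre's
K-functional. -/
theorem inf_smul_apply_le (t : ℝ≥0) (x y : E) : (p ⊓ t • q) x ≤ p y + t * q (x - y) := by
  rw [inf_apply]
  exact ciInf_le (f := fun u => p u + (t • q) (x - u))
    ⟨0, by rintro _ ⟨u, rfl⟩; positivity⟩ y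

theorem le_inf_smul_apply {t : ℝ≥0} {x : E} {c : ℝ} (h : ∀ y, c ≤ p y + t * q (x - y)) :
    c ≤ (p ⊓ t • q) x := by
  rw [inf_apply]
  exact le_ciInf h

/-- The two trivial decompositions of `x` bound the K-functional by `min 1 t * p x`, and `t ^ (-θ) *
min 1 t ≤ 1`. This makes the family bounded above; otherwise its supremum would be a default value.
-/
theorem rpow_smul_inf_smul_le (hqp : q ≤ p) (h0 : 0 ≤ θ) (h1 : θ ≤ 1) {t : ℝ≥0} (ht : 0 < t) :
    (t ^ (-θ)) • (p ⊓ t • q) ≤ p := by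
  intro x
  change ((t ^ (-θ) : ℝ≥0) : ℝ) * (p ⊓ t • q) x ≤ p x
  have ht' : (0 : ℝ) < t := ht
  rw [NNReal.coe_rpow]
  have hpos : (0 : ℝ) < (t : ℝ) ^ (-θ) := Real.rpow_pos_of_pos ht' _
  rcases le_total (t : ℝ) 1 with h | h
  · have h2 : (p ⊓ t • q) x ≤ t * p x := by
      refine (inf_smul_apply_le t x 0).trans ?_
      simp only [map_zero, sub_zero, zero_add]
      exact mul_le_mul_of_nonneg_left (hqp x) ht'.le
    calc (t : ℝ) ^ (-θ) * (p ⊓ t • q) x ≤ (t : ℝ) ^ (-θ) * (t * p x) :=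
          mul_le_mul_of_nonneg_left h2 hpos.le
      _ = (t : ℝ) ^ (1 - θ) * p x := by
          rw [← mul_assoc, sub_eq_neg_add, Real.rpow_add ht', Real.rpow_one]
      _ ≤ 1 * p x := mul_le_mul_of_nonneg_right
          (Real.rpow_le_one ht'.le h (by linarith)) (apply_nonneg _ _)
      _ = p x := one_mul _
  · have h2 : (p ⊓ t • q) x ≤ p x := by
      refine (inf_smul_apply_le t x x).trans ?_
      simp
    calc (t : ℝ) ^ (-θ) * (p ⊓ t • q) x ≤ 1 * p x :=
          mul_le_mul (Real.rpow_le_one_of_one_le_of_nonpos h (by linarith)) h2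
            (apply_nonneg _ _) zero_le_one
      _ = p x := one_mul _

theorem interpolation_le (hqp : q ≤ p) (h0 : 0 ≤ θ) (h1 : θ ≤ 1) : interpolation p q θ ≤ p :=
  have : Nonempty {t : ℝ≥0 // 0 < t} := ⟨⟨1, one_pos⟩⟩
  ciSup_le fun t => rpow_smul_inf_smul_le hqp h0 h1 t.2

theorem rpow_mul_inf_smul_le_interpolation (hqp : q ≤ p) (h0 : 0 ≤ θ) (h1 : θ ≤ 1) {t : ℝ≥0}
    (ht : 0 < t) (x : E) : (t : ℝ) ^ (-θ) * (p ⊓ t • q) x ≤ interpolation p q θ x := by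
  have hb : BddAbove (Set.range fun t : {t : ℝ≥0 // 0 < t} =>
      ((t : ℝ≥0) ^ (-θ)) • (p ⊓ (t : ℝ≥0) • q)) :=
    ⟨p, by rintro _ ⟨t, rfl⟩; exact rpow_smul_inf_smul_le hqp h0 h1 t.2⟩
  have h := le_ciSup hb ⟨t, ht⟩ x
  rw [← NNReal.coe_rpow]
  exact h

theorem interpolation_apply_le (hqp : q ≤ p) (h0 : 0 ≤ θ) (h1 : θ ≤ 1) {x : E} {c : ℝ}
    (h : ∀ t : ℝ≥0, 0 < t → (t : ℝ) ^ (-θ) * (p ⊓ t • q) x ≤ c) : interpolation p q θ x ≤ c := by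
  have hb : BddAbove (Set.range fun t : {t : ℝ≥0 // 0 < t} =>
      ((t : ℝ≥0) ^ (-θ)) • (p ⊓ (t : ℝ≥0) • q)) :=
    ⟨p, by rintro _ ⟨t, rfl⟩; exact rpow_smul_inf_smul_le hqp h0 h1 t.2⟩
  have : Nonempty {t : ℝ≥0 // 0 < t} := ⟨⟨1, one_pos⟩⟩
  rw [interpolation, Seminorm.iSup_apply hb]
  refine ciSup_le fun t => ?_
  have := h t t.2
  rw [← NNReal.coe_rpow] at this
  exact this

/-- A linear map bounded by `a` for `p` and by `b` for `q` is bounded by `a ^ (1 - θ) * b ^ θ` for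
the interpolation seminorm. -/
theorem interpolation_map_le (hqp : q ≤ p) (h0 : 0 ≤ θ) (h1 : θ ≤ 1) (D : E →ₗ[ℂ] E) {a b : ℝ}
    (ha : 0 < a) (hb : 0 < b) (hp : ∀ x, p (D x) ≤ a * p x) (hq : ∀ x, q (D x) ≤ b * q x) (x : E) :
    interpolation p q θ (D x) ≤ a ^ (1 - θ) * b ^ θ * interpolation p q θ x := by
  lift a to ℝ≥0 using ha.le
  lift b to ℝ≥0 using hb.le
  refine interpolation_apply_le hqp h0 h1 fun t ht => ?_
  have ha' : (0 : ℝ) < a := ha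
  have hb' : (0 : ℝ) < b := hb
  have ht' : (0 : ℝ) < t := ht
  -- Applying `D` to a decomposition of `x` costs `a * p y + t * b * q (x - y)`, which is `a` times
  -- the cost of the decomposition at the parameter `t * b / a`.
  have hu : 0 < t * b / a := div_pos (mul_pos ht (by exact_mod_cast hb)) (by exact_mod_cast ha)
  have h2 : (p ⊓ t • q) (D x) ≤ a * (p ⊓ (t * b / a) • q) x := by
    rw [mul_comm, ← div_le_iff₀ ha']
    refine le_inf_smul_apply fun y => ?_
    rw [div_le_iff₀ ha']
    refine (inf_smul_apply_le t (D x) (D y)).trans ?_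
    rw [← map_sub]
    have e1 := hp y
    have e2 := mul_le_mul_of_nonneg_left (hq (x - y)) ht'.le
    push_cast
    have e3 : (p y + t * b / a * q (x - y)) * a = a * p y + t * (b * q (x - y)) := by
      field_simp
    rw [e3]
    linarith
  have h3 := rpow_mul_inf_smul_le_interpolation hqp h0 h1 hu x
  have h4 : (t : ℝ) ^ (-θ) * a =
      (a : ℝ) ^ (1 - θ) * (b : ℝ) ^ θ * ((t * b / a : ℝ≥0) : ℝ) ^ (-θ) := by
    push_cast
    rw [Real.div_rpow (by positivity) ha'.le, Real.mul_rpow ht'.le hb'.le, Real.rpow_sub ha',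
      Real.rpow_one, Real.rpow_neg hb'.le, Real.rpow_neg ha'.le]
    field_simp
  calc (t : ℝ) ^ (-θ) * (p ⊓ t • q) (D x)
      ≤ (t : ℝ) ^ (-θ) * (a * (p ⊓ (t * b / a) • q) x) :=
        mul_le_mul_of_nonneg_left h2 (Real.rpow_nonneg ht'.le _)
    _ = (a : ℝ) ^ (1 - θ) * (b : ℝ) ^ θ *
        (((t * b / a : ℝ≥0) : ℝ) ^ (-θ) * (p ⊓ (t * b / a) • q) x) := by
        rw [← mul_assoc, h4, mul_assoc]
    _ ≤ _ := mul_le_mul_of_nonneg_left h3 (by positivity)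

end Seminorm

/-! ### Completed operator algebra of a seminorm, where spectral theory applies. -/

section Completion

variable (R : Type*) [SeminormedRing R] [NormedAlgebra ℂ R]

/-- The completion of a complex seminormed algebra as a Banach algebra. -/
abbrev BanachCompletion : Type _ := UniformSpace.Completion R

instance BanachCompletion.instNormedAlgebra : NormedAlgebra ℂ (BanachCompletion R) where
  norm_smul_le c x := NormedSpace.norm_smul_le c x

/-- The embedding of a complex seminormed algebra in its completion. -/
def BanachCompletion.of : R →ₐ[ℂ] BanachCompletion R where
  __ := (UniformSpace.Completion.coeRingHom : R →+* UniformSpace.Completion R)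
  commutes' _ := rfl

theorem BanachCompletion.norm_of (a : R) : ‖BanachCompletion.of R a‖ = ‖a‖ :=
  UniformSpace.Completion.norm_coe a

end Completion

/-- The space `E` with the topology and the norm given by the seminorm `p`. -/
def SeminormSpace {E : Type*} [AddCommGroup E] [Module ℂ E] (_p : Seminorm ℂ E) : Type _ := E

namespace SeminormSpace

variable {E : Type*} [AddCommGroup E] [Module ℂ E] (p : Seminorm ℂ E)

instance : SeminormedAddCommGroup (SeminormSpace p) :=
  p.toAddGroupSeminorm.toSeminormedAddCommGroup

instance : Module ℂ (SeminormSpace p) := inferInstanceAs (Module ℂ E)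

instance : NormedSpace ℂ (SeminormSpace p) where
  norm_smul_le c x := (map_smul_eq_mul p c x).le

variable {A : Type*} [NormedRing A] [NormedAlgebra ℂ A] (N : Seminorm ℂ A)
  (hN : ∀ g x, N (g * x) ≤ ‖g‖ * N x)

/-- The left regular representation of a normed algebra on itself with a new seminorm. -/
def leftMul : A →ₐ[ℂ] (SeminormSpace N →L[ℂ] SeminormSpace N) where
  toFun g := LinearMap.mkContinuous (E := SeminormSpace N) (F := SeminormSpace N)
    (LinearMap.mulLeft ℂ g) ‖g‖ (hN g)
  map_one' := by ext x; exact one_mul (M := A) x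
  map_mul' g h := by ext x; exact mul_assoc (G := A) g h x
  map_zero' := by ext x; exact zero_mul (M₀ := A) x
  map_add' g h := by ext x; exact add_mul (R := A) g h x
  commutes' c := by ext x; exact (Algebra.smul_def (A := A) c x).symm

/-- The left regular representation in the completed operator algebra. -/
def completedLeftMul : A →ₐ[ℂ] BanachCompletion (SeminormSpace N →L[ℂ] SeminormSpace N) :=
  (BanachCompletion.of _).comp (leftMul N hN)

theorem norm_completedLeftMul (g : A) : ‖completedLeftMul N hN g‖ = ‖leftMul N hN g‖ :=
  BanachCompletion.norm_of _ _

theorem norm_completedLeftMul_le {g : A} {c : ℝ} (hc : 0 ≤ c) (h : ∀ x, N (g * x) ≤ c * N x) :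
    ‖completedLeftMul N hN g‖ ≤ c := by
  rw [norm_completedLeftMul]
  exact ContinuousLinearMap.opNorm_le_bound _ hc h

theorem le_norm_completedLeftMul (g x : A) : N (g * x) ≤ ‖completedLeftMul N hN g‖ * N x := by
  rw [norm_completedLeftMul]
  exact (leftMul N hN g).le_opNorm (x : SeminormSpace N)

/-- Equality fails when `N` vanishes identically. -/
theorem norm_one_le : ‖(1 : BanachCompletion (SeminormSpace N →L[ℂ] SeminormSpace N))‖ ≤ 1 := by
  rw [← map_one (BanachCompletion.of _), BanachCompletion.norm_of]
  exact ContinuousLinearMap.norm_id_le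

end SeminormSpace

/-! ### Gelfand's formula and separating polynomials. -/

section Spectral

variable {A : Type*} [NormedRing A] [NormedAlgebra ℂ A] [CompleteSpace A]

theorem eventually_norm_pow_le_of_spectrum {a : A} {r R : ℝ} (hr : ∀ z ∈ spectrum ℂ a, ‖z‖ ≤ r)
    (h0 : 0 ≤ r) (hR : r < R) : ∀ᶠ n : ℕ in atTop, ‖a ^ n‖ ≤ R ^ n := by
  have h1 : spectralRadius ℂ a < ENNReal.ofReal R := by
    refine lt_of_le_of_lt ?_ ((ENNReal.ofReal_lt_ofReal_iff (h0.trans_lt hR)).2 hR)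
    refine iSup₂_le fun z hz => ?_
    exact (ofReal_norm z).symm.le.trans (ENNReal.ofReal_le_ofReal (hr z hz))
  filter_upwards [(spectrum.pow_norm_pow_one_div_tendsto_nhds_spectralRadius a).eventually_lt_const
    h1, eventually_gt_atTop 0] with n hn hn0
  rw [ENNReal.ofReal_lt_ofReal_iff (h0.trans_lt hR)] at hn
  calc ‖a ^ n‖ = (‖a ^ n‖ ^ (1 / n : ℝ)) ^ n := by
        rw [← Real.rpow_natCast, ← Real.rpow_mul (norm_nonneg _), one_div,
          inv_mul_cancel₀ (by positivity), Real.rpow_one]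
    _ ≤ R ^ n := pow_le_pow_left₀ (by positivity) hn.le n

/-- Polynomials that are small on `[-r, r]`, bounded by `2` on `[-1, 1]` and not small at `x`. -/
theorem exists_polynomial_separating {r x ε : ℝ} (hr : 0 ≤ r) (hx : r < |x|) (hx1 : |x| ≤ 1)
    (hε : 0 < ε) (hε1 : ε ≤ 1) : ∃ Q : ℝ[X], (∀ y, |y| ≤ r → |Q.eval y| ≤ ε) ∧
      (∀ y, |y| ≤ 1 → |Q.eval y| ≤ 2) ∧ |x| - r - ε ≤ |Q.eval x| := by
  -- Weierstrass approximation of a function that vanishes on `[-r, r]`, is at most `1` on `[-1, 1]`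
  -- and equals `|x| - r` at `x`.
  obtain ⟨Q, hQ⟩ := exists_polynomial_near_of_continuousOn (-1) 1 (fun y => max 0 (|y| - r))
    (by fun_prop) ε hε
  have hQ' : ∀ y, |y| ≤ 1 → |Q.eval y - max 0 (|y| - r)| < ε := fun y hy => hQ y (abs_le.1 hy)
  refine ⟨Q, fun y hy => ?_, fun y hy => ?_, ?_⟩
  · have h := hQ' y (by linarith)
    rw [max_eq_left (by linarith), sub_zero] at h
    exact h.le
  · have h := abs_lt.1 (hQ' y hy)
    have h1 : max 0 (|y| - r) ≤ 1 := max_le zero_le_one (by linarith)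
    have h2 : 0 ≤ max 0 (|y| - r) := le_max_left _ _
    exact abs_le.2 ⟨by linarith, by linarith⟩
  · have h := abs_lt.1 (hQ' x hx1)
    rw [max_eq_right (by linarith)] at h
    exact le_trans (by linarith) (le_abs_self _)

end Spectral

/-! ### The spectral radius for interpolation seminorms. -/

section SpectralInterpolation

variable {A : Type*} [NormedRing A] [NormedAlgebra ℂ A] {q : Seminorm ℂ A} {θ : ℝ}

/-- This is interpolation with equal bounds at both ends; `g = 0` is separate because those bounds
must be positive. -/
theorem interpolation_mul_le (hq : q ≤ normSeminorm ℂ A) (hqm : ∀ g x, q (g * x) ≤ ‖g‖ * q x)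
    (h0 : 0 ≤ θ) (h1 : θ ≤ 1) (g x : A) :
    (normSeminorm ℂ A).interpolation q θ (g * x) ≤
      ‖g‖ * (normSeminorm ℂ A).interpolation q θ x := by
  rcases eq_or_ne g 0 with rfl | hg
  · simp
  have hg' : 0 < ‖g‖ := norm_pos_iff.2 hg
  have h := Seminorm.interpolation_map_le hq h0 h1 (LinearMap.mulLeft ℂ g) 
    hg' hg' (fun x => norm_mul_le g x) (hqm g) x
  rwa [← Real.rpow_add hg', sub_add_cancel, Real.rpow_one] at h

theorem exists_pos_mul_rpow_add_lt (hθ : 0 < θ) {c d : ℝ} (hd : 0 < d) :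
    ∃ ε : ℝ, 0 < ε ∧ ε ≤ 1 ∧ c * ε ^ θ + ε < d := by
  have hc : Continuous fun ε : ℝ => c * ε ^ θ + ε :=
    ((Real.continuous_rpow_const hθ.le).const_mul c).add continuous_id
  have ht : Tendsto (fun ε : ℝ => c * ε ^ θ + ε) (𝓝[>] 0) (𝓝 0) := by
    have := hc.tendsto 0
    rw [Real.zero_rpow hθ.ne', mul_zero, zero_add] at this
    exact this.mono_left nhdsWithin_le_nhds
  obtain ⟨ε, h1, h2, h3⟩ := ((ht.eventually_lt_const hd).and
    (eventually_mem_nhdsWithin.and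
      (eventually_nhdsWithin_of_eventually_nhds (Iic_mem_nhds one_pos)))).exists
  exact ⟨ε, h2, h3, h1⟩

variable [CompleteSpace A]

/-- If an element with real spectrum has polynomial functional calculus on `[-r, r]` for the
seminorm `q`, then its powers are of exponential type at most `r` for any interpolation seminorm
strictly between the norm and `q`. -/
theorem eventually_interpolation_pow_mul_le (hq : q ≤ normSeminorm ℂ A)
    (hqm : ∀ g x, q (g * x) ≤ ‖g‖ * q x) (h0 : 0 < θ) (h1 : θ ≤ 1) {f : A}
    (hf : ∀ z ∈ spectrum ℂ f, z.im = 0 ∧ ‖z‖ ≤ 1) {r R : ℝ} (hr : 0 ≤ r) (hR : r < R)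
    (hQ : ∀ (Q : ℝ[X]) (c : ℝ), 0 ≤ c → (∀ y, |y| ≤ r → |Q.eval y| ≤ c) →
      ∀ x, q (aeval f (Q.map (algebraMap ℝ ℂ)) * x) ≤ c * q x) (x : A) :
    ∀ᶠ n : ℕ in atTop, (normSeminorm ℂ A).interpolation q θ (f ^ n * x) ≤
      R ^ n * (normSeminorm ℂ A).interpolation q θ x := by
  set N := (normSeminorm ℂ A).interpolation q θ
  have hN : ∀ g x, N (g * x) ≤ ‖g‖ * N x := interpolation_mul_le hq hqm h0.le h1
  let φ := SeminormSpace.completedLeftMul N hN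
  have hspec : ∀ z ∈ spectrum ℂ (φ f), ‖z‖ ≤ r := by
    intro z hz
    -- Homomorphisms shrink spectra, so `z` is real and in `[-1, 1]`, where `Q` is controlled.
    obtain ⟨him, hz1⟩ := hf z (AlgHom.spectrum_apply_subset φ f hz)
    obtain ⟨y, rfl⟩ : ∃ y : ℝ, (y : ℂ) = z := ⟨z.re, Complex.ext rfl him.symm⟩
    rw [Complex.norm_real, Real.norm_eq_abs] at hz1 ⊢
    by_contra! hy
    -- The `3` is any number above the bound `2` for `Q` on `[-1, 1]`; the slack is spent in
    -- Gelfand's formula.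
    obtain ⟨ε, hε, hε1, hεy⟩ := exists_pos_mul_rpow_add_lt h0 (c := 3) (sub_pos.2 hy)
    obtain ⟨Q, hQr, hQ1, hQy⟩ := exists_polynomial_separating hr hy hz1 hε hε1
    set g := aeval f (Q.map (algebraMap ℝ ℂ)) with hg
    have heval : ∀ t : ℝ, eval (t : ℂ) (Q.map (algebraMap ℝ ℂ)) = (Q.eval t : ℝ) := fun t => by
      rw [eval_map]
      exact eval₂_at_apply (algebraMap ℝ ℂ) t
    have hgs : ∀ w ∈ spectrum ℂ g, ‖w‖ ≤ 2 := by
      intro w hw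
      have hne : Nontrivial A := by
        by_contra h
        rw [not_nontrivial_iff_subsingleton] at h
        rw [spectrum.of_subsingleton] at hw
        exact hw
      rw [hg, spectrum.map_polynomial_aeval] at hw
      obtain ⟨v, hv, rfl⟩ := hw
      obtain ⟨hv0, hv1⟩ := hf v hv
      obtain ⟨t, rfl⟩ : ∃ t : ℝ, (t : ℂ) = v := ⟨v.re, Complex.ext rfl hv0.symm⟩
      rw [Complex.norm_real, Real.norm_eq_abs] at hv1
      change ‖eval (t : ℂ) (Q.map (algebraMap ℝ ℂ))‖ ≤ 2
      rw [heval, Complex.norm_real]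
      exact hQ1 t hv1
    obtain ⟨n, hn, hn0⟩ := ((eventually_norm_pow_le_of_spectrum hgs zero_le_two
      (by norm_num : (2 : ℝ) < 3)).and (eventually_gt_atTop 0)).exists
    have hbound : ‖φ (g ^ n)‖ ≤ (3 * ε ^ θ) ^ n := by
      refine SeminormSpace.norm_completedLeftMul_le N hN (by positivity) fun x => ?_
      have hqn : ∀ x, q (g ^ n * x) ≤ ε ^ n * q x := by
        have := hQ (Q ^ n) (ε ^ n) (by positivity) fun y hy => by
          rw [eval_pow, abs_pow]
          exact pow_le_pow_left₀ (abs_nonneg _) (hQr y hy) n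
        simpa only [Polynomial.map_pow, map_pow] using this
      have h3 := Seminorm.interpolation_map_le hq h0.le h1 (LinearMap.mulLeft ℂ (g ^ n))
        (a := 3 ^ n) (b := ε ^ n) (by positivity) (by positivity)
        (fun x => (norm_mul_le _ x).trans (mul_le_mul_of_nonneg_right hn (norm_nonneg x)))
        hqn x
      refine h3.trans (mul_le_mul_of_nonneg_right ?_ (apply_nonneg _ _))
      rw [← Real.rpow_natCast, ← Real.rpow_natCast, ← Real.rpow_natCast,
        ← Real.rpow_mul (by norm_num), ← Real.rpow_mul hε.le, mul_comm (n : ℝ) θ,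
        Real.rpow_mul hε.le, Real.mul_rpow (by norm_num) (by positivity)]
      refine mul_le_mul_of_nonneg_right (Real.rpow_le_rpow_of_exponent_le (by norm_num) ?_)
        (by positivity)
      have : (0 : ℝ) ≤ n := n.cast_nonneg
      nlinarith
    -- Spectral mapping turns the norm bound into `|Q y| ≤ 3 * ε ^ θ`, against `|Q y| ≥ |y| - r -
    -- ε`.
    have hmem : ((Q.eval y : ℝ) : ℂ) ^ n ∈ spectrum ℂ (φ (g ^ n)) := by
      rw [map_pow]
      refine spectrum.pow_image_subset (φ g) n ⟨_, ?_, rfl⟩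
      rw [← heval, hg, ← aeval_algHom_apply]
      exact spectrum.subset_polynomial_aeval _ _ ⟨_, hz, rfl⟩
    have hle := (spectrum.norm_le_norm_mul_of_mem hmem).trans
      (mul_le_of_le_one_right (norm_nonneg _) (SeminormSpace.norm_one_le N))
    rw [norm_pow, Complex.norm_real, Real.norm_eq_abs] at hle
    have hfin := le_of_pow_le_pow_left₀ hn0.ne' (by positivity) (hle.trans hbound)
    linarith
  filter_upwards [eventually_norm_pow_le_of_spectrum hspec hr hR] with n hn
  refine (SeminormSpace.le_norm_completedLeftMul N hN (f ^ n) x).trans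
    (mul_le_mul_of_nonneg_right ?_ (apply_nonneg _ _))
  rw [map_pow]
  exact hn

end SpectralInterpolation

/-- The continuous functional calculus bounds the norm by the supremum over the spectrum, which lies
in `[-‖T‖, ‖T‖]`. -/
theorem norm_aeval_le_of_isSelfAdjoint {B : Type*} [CStarAlgebra B] {T : B} (hT : IsSelfAdjoint T)
    (Q : ℝ[X]) {c : ℝ} (hc : 0 ≤ c) (hQ : ∀ y, |y| ≤ ‖T‖ → |Q.eval y| ≤ c) :
    ‖aeval T (Q.map (algebraMap ℝ ℂ))‖ ≤ c := by
  rw [aeval_map_algebraMap, ← cfc_polynomial Q T]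
  refine norm_cfc_le hc fun y hy => hQ y ?_
  rcases subsingleton_or_nontrivial B with h | h
  · rw [spectrum.of_subsingleton] at hy
    exact hy.elim
  · exact spectrum.norm_le_norm_of_mem hy

/-! ### Uniform measures and their convolution powers. -/

namespace GroupL1

variable {G : Type*}

/-- The `ℓ²` norm as a seminorm on `ℓ¹(G)`. -/
def l2Seminorm (G : Type*) : Seminorm ℂ (GroupL1 G) :=
  (normSeminorm ℂ (lp (fun _ : G => ℂ) 2)).comp toL2

theorem l2Seminorm_apply (f : GroupL1 G) : l2Seminorm G f = ‖toL2 f‖ := rfl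

theorem l2Seminorm_le : l2Seminorm G ≤ normSeminorm ℂ (GroupL1 G) := fun f => norm_toL2_le f

theorem norm_sum_le_norm (f : GroupL1 G) (F : Finset G) : ‖∑ x ∈ F, f x‖ ≤ ‖f‖ := by
  rw [norm_def]
  exact (norm_sum_le _ _).trans (f.summable_norm.sum_le_tsum F fun _ _ => norm_nonneg _)

theorem norm_sum_le_sqrt_card_mul (f : GroupL1 G) (F : Finset G) :
    ‖∑ x ∈ F, f x‖ ≤ √(F.card) * l2Seminorm G f := by
  refine (norm_sum_le _ _).trans (le_of_sq_le_sq ?_ (by positivity))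
  rw [mul_pow, Real.sq_sqrt (Nat.cast_nonneg _), l2Seminorm_apply]
  refine sq_sum_le_card_mul_sum_sq.trans (mul_le_mul_of_nonneg_left ?_ (Nat.cast_nonneg _))
  have h := lp.sum_rpow_le_norm_rpow (p := 2) (by simp) (toL2 f) F
  simpa using h

/-- A function of sum one supported on few points has large interpolation seminorm. -/
theorem rpow_le_interpolation {f : GroupL1 G} {F : Finset G} (hf : HasSum f 1)
    (hF : ∀ x ∉ F, f x = 0) {θ m : ℝ} (h0 : 0 ≤ θ) (h1 : θ ≤ 1) (hm : 0 < m)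
    (hFm : (F.card : ℝ) ≤ m) :
    m ^ (-(θ / 2)) ≤ (normSeminorm ℂ (GroupL1 G)).interpolation (l2Seminorm G) θ f := by
  have hsum : ∑ x ∈ F, f x = 1 := (hasSum_sum_of_ne_finset_zero hF).unique hf
  -- Summation over `F` is bounded by `1` on `ℓ¹` and by `√m` on `ℓ²`, so the parameter `√m`
  -- balances the two.
  have hK : 1 ≤ (normSeminorm ℂ (GroupL1 G) ⊓ (NNReal.sqrt m.toNNReal) • l2Seminorm G) f := by
    refine Seminorm.le_inf_smul_apply fun y => ?_
    have h : (1 : ℂ) = ∑ x ∈ F, y x + ∑ x ∈ F, (f - y) x := by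
      rw [← Finset.sum_add_distrib, ← hsum]
      refine Finset.sum_congr rfl fun x _ => ?_
      rw [← add_apply, add_sub_cancel]
    calc (1 : ℝ) = ‖(1 : ℂ)‖ := norm_one.symm
      _ ≤ ‖y‖ + √(F.card) * l2Seminorm G (f - y) := by
        rw [h]
        exact (norm_add_le _ _).trans
          (add_le_add (norm_sum_le_norm y F) (norm_sum_le_sqrt_card_mul (f - y) F))
      _ ≤ _ := by
        refine add_le_add le_rfl (mul_le_mul_of_nonneg_right ?_ (apply_nonneg _ _))
        rw [Real.coe_sqrt, Real.coe_toNNReal _ hm.le]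
        exact Real.sqrt_le_sqrt hFm
  have ht : 0 < NNReal.sqrt m.toNNReal := NNReal.sqrt_pos.2 (Real.toNNReal_pos.2 hm)
  have h := Seminorm.rpow_mul_inf_smul_le_interpolation l2Seminorm_le h0 h1 ht f
  refine le_trans ?_ ((le_mul_of_one_le_right (by positivity) hK).trans h)
  rw [Real.coe_sqrt, Real.coe_toNNReal _ hm.le, Real.sqrt_eq_rpow, ← Real.rpow_mul hm.le]
  exact le_of_eq (by ring_nf)

/-- The uniform probability measure on a finite set. -/
def uniform (S : Finset G) : GroupL1 G :=
  mk (Set.indicator S fun _ => (S.card : ℂ)⁻¹) (summable_of_hasFiniteSupport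
    (S.finite_toSet.subset fun x hx => by
      by_contra h
      exact hx (by simp [Set.indicator_of_notMem h])))

theorem uniform_apply_of_mem {S : Finset G} {x : G} (hx : x ∈ S) :
    uniform S x = (S.card : ℂ)⁻¹ :=
  Set.indicator_of_mem (s := (S : Set G)) hx fun _ => (S.card : ℂ)⁻¹

theorem uniform_apply_of_notMem {S : Finset G} {x : G} (hx : x ∉ S) : uniform S x = 0 :=
  Set.indicator_of_notMem (s := (S : Set G)) hx fun _ => (S.card : ℂ)⁻¹

theorem finite_support_uniform (S : Finset G) : (Function.support (uniform S : G → ℂ)).Finite :=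
  S.finite_toSet.subset fun x hx => by
    by_contra h
    exact hx (uniform_apply_of_notMem h)

theorem norm_uniform {S : Finset G} (hS : S.Nonempty) : ‖uniform S‖ = 1 := by
  rw [norm_def, tsum_eq_sum (s := S) fun x hx => by rw [uniform_apply_of_notMem hx, norm_zero],
    Finset.sum_congr rfl fun x hx => by rw [uniform_apply_of_mem hx], Finset.sum_const,
    nsmul_eq_mul, norm_inv, Complex.norm_natCast]
  exact mul_inv_cancel₀ (Nat.cast_ne_zero.2 hS.card_pos.ne')

variable [Group G]

/-- This carries operator norm bounds on `ℓ²(G)` over to multiplication in `ℓ¹(G)` measured by the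
`ℓ²` seminorm. -/
theorem aeval_convL2_toL2 (f x : GroupL1 G) (P : ℂ[X]) :
    aeval (convL2 f) P (toL2 x) = toL2 (aeval f P * x) := by
  induction P using Polynomial.induction_on' generalizing x with
  | add p q hp hq =>
    rw [map_add, map_add, _root_.add_apply, hp, hq, add_mul, map_add]
  | monomial n a =>
    have h : ∀ (n : ℕ) x, (convL2 f ^ n) (toL2 x) = toL2 (f ^ n * x) := by
      intro n
      induction n with
      | zero => intro x; simp
      | succ n ih =>
        intro x
        rw [pow_succ, mul_apply_eq_comp, convL2_toL2, ih, pow_succ, mul_assoc]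
    rw [aeval_monomial, aeval_monomial, ← Algebra.smul_def, ← Algebra.smul_def,
      _root_.smul_apply, h, smul_mul_assoc, map_smul]

theorem l2Seminorm_mul_le (g f : GroupL1 G) : l2Seminorm G (g * f) ≤ ‖g‖ * l2Seminorm G f := by
  rw [l2Seminorm_apply, l2Seminorm_apply, ← convL2_toL2]
  exact ((convL2 g).le_opNorm _).trans
    (mul_le_mul_of_nonneg_right (norm_convL2_le g) (norm_nonneg _))

theorem isSelfAdjoint_uniform {S : Finset G} (hS : ∀ x ∈ S, x⁻¹ ∈ S) :
    IsSelfAdjoint (uniform S) := by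
  refine ext fun x => ?_
  rw [star_apply]
  by_cases hx : x ∈ S
  · rw [uniform_apply_of_mem hx, uniform_apply_of_mem (hS x hx)]
    simp
  · rw [uniform_apply_of_notMem hx, uniform_apply_of_notMem fun h => hx (by simpa using hS _ h)]
    simp

theorem convL2_uniform (S : Finset G) (ξ : lp (fun _ : G => ℂ) 2) :
    convL2 (uniform S) ξ = (S.card : ℂ)⁻¹ • ∑ s ∈ S, leftRegular s ξ := by
  rw [← (hasSum_convL2 (uniform S) ξ).tsum_eq, tsum_eq_sum (s := S) fun x hx => by
    rw [uniform_apply_of_notMem hx, zero_smul], Finset.smul_sum]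
  exact Finset.sum_congr rfl fun x hx => by rw [uniform_apply_of_mem hx]

theorem uniform_mul_apply (S : Finset G) (g : GroupL1 G) (x : G) :
    (uniform S * g) x = (S.card : ℂ)⁻¹ * ∑ s ∈ S, g (s⁻¹ * x) := by
  rw [mul_apply, tsum_eq_sum (s := S) fun x hx => by
    rw [uniform_apply_of_notMem hx, zero_mul], Finset.mul_sum]
  exact Finset.sum_congr rfl fun x hx => by rw [uniform_apply_of_mem hx]

theorem hasSum_uniform_pow {S : Finset G} (hS : S.Nonempty) (n : ℕ) :
    HasSum (uniform S ^ n : GroupL1 G) 1 ∧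
      ∃ F : Finset G, F.card ≤ S.card ^ n ∧ ∀ x ∉ F, (uniform S ^ n) x = 0 := by
  classical
  induction n with
  | zero =>
    have h : ∀ x ∉ ({1} : Finset G), (uniform S ^ 0) x = 0 := fun x hx => by
      rw [pow_zero, one_apply_of_ne (by simpa using hx)]
    refine ⟨?_, {1}, by simp, h⟩
    have := hasSum_sum_of_ne_finset_zero (L := .unconditional G) h
    rwa [Finset.sum_singleton, pow_zero, one_apply_one] at this
  | succ n ih =>
    obtain ⟨hsum, F, hF, hF0⟩ := ih
    refine ⟨?_, S * F, ?_, fun x hx => ?_⟩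
    · have h : HasSum (fun x => (S.card : ℂ)⁻¹ * ∑ s ∈ S, (uniform S ^ n) (s⁻¹ * x))
          ((S.card : ℂ)⁻¹ * ∑ s ∈ S, 1) :=
        (hasSum_sum fun s _ => (Equiv.mulLeft s⁻¹).hasSum_iff.2 hsum).mul_left _
      rw [Finset.sum_const, nsmul_one, inv_mul_cancel₀ (Nat.cast_ne_zero.2 hS.card_pos.ne')] at h
      convert h using 1
      ext x
      rw [pow_succ', uniform_mul_apply]
    · rw [pow_succ']
      exact Finset.card_mul_le.trans (Nat.mul_le_mul_left _ hF)
    · rw [pow_succ', uniform_mul_apply, Finset.sum_eq_zero, mul_zero]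
      intro s hs
      refine hF0 _ fun h => hx ?_
      rw [← mul_inv_cancel_left s x]
      exact Finset.mul_mem_mul hs h

theorem norm_one_le : ‖(1 : GroupL1 G)‖ ≤ 1 := by
  rw [norm_def, tsum_eq_single 1 fun x hx => by rw [one_apply_of_ne hx, norm_zero], one_apply_one,
    norm_one]

end GroupL1

/-! ### Kesten's condition. -/

open GroupL1

theorem IsQuasiHermitianGroup.one_le_norm_convL2_uniform {G : Type*} [Group G]
    (hG : IsQuasiHermitianGroup G) {S : Finset G} (hS : S.Nonempty) (hS' : ∀ x ∈ S, x⁻¹ ∈ S) :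
    1 ≤ ‖convL2 (uniform S)‖ := by
  by_contra! hlt
  obtain ⟨R, hrR, hR1⟩ := exists_between hlt
  have hsa := isSelfAdjoint_uniform hS'
  have hm : (0 : ℝ) < S.card := Nat.cast_pos.2 hS.card_pos
  have hf : ∀ z ∈ spectrum ℂ (uniform S), z.im = 0 ∧ ‖z‖ ≤ 1 := fun z hz =>
    ⟨hG _ (finite_support_uniform S) hsa z hz, by
      have h := spectrum.norm_le_norm_mul_of_mem hz
      rw [norm_uniform hS, one_mul] at h
      exact h.trans norm_one_le⟩
  -- Both bounds are exponential in `n`, so a single `n > 0` suffices and `n`-th roots can be taken.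
  have key : ∀ θ : ℝ, 0 < θ → θ ≤ 1 → (S.card : ℝ) ^ (-(θ / 2)) ≤ R := by
    intro θ h0 h1
    have h := eventually_interpolation_pow_mul_le l2Seminorm_le l2Seminorm_mul_le h0 h1 hf
      (norm_nonneg _) hrR (fun Q c hc hQ x => by
        rw [l2Seminorm_apply, l2Seminorm_apply, ← aeval_convL2_toL2]
        exact (ContinuousLinearMap.le_opNorm _ _).trans (mul_le_mul_of_nonneg_right
          (norm_aeval_le_of_isSelfAdjoint (isSelfAdjoint_convL2 hsa) Q hc hQ) (norm_nonneg _))) 1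
    obtain ⟨n, hn, hn0⟩ := (h.and (eventually_gt_atTop 0)).exists
    obtain ⟨hsum, F, hF, hF0⟩ := hasSum_uniform_pow hS n
    have h2 := rpow_le_interpolation hsum hF0 h0.le h1 (pow_pos hm n) (by exact_mod_cast hF)
    have h3 := (Seminorm.interpolation_le l2Seminorm_le h0.le h1 (1 : GroupL1 G)).trans norm_one_le
    have hR0 : 0 ≤ R := (norm_nonneg _).trans hrR.le
    rw [mul_one] at hn
    refine le_of_pow_le_pow_left₀ hn0.ne' hR0 ?_
    calc ((S.card : ℝ) ^ (-(θ / 2))) ^ n = ((S.card : ℝ) ^ n) ^ (-(θ / 2)) := by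
          rw [← Real.rpow_natCast, ← Real.rpow_natCast, ← Real.rpow_mul hm.le,
            ← Real.rpow_mul hm.le, mul_comm]
      _ ≤ R ^ n := h2.trans (hn.trans (mul_le_of_le_one_right (pow_nonneg hR0 n) h3))
  have hc : Tendsto (fun θ : ℝ => (S.card : ℝ) ^ (-(θ / 2))) (𝓝[>] 0) (𝓝 1) := by
    have h : Continuous fun θ : ℝ => (S.card : ℝ) ^ (-(θ / 2)) :=
      (Real.continuous_const_rpow hm.ne').comp (by fun_prop)
    have := h.tendsto 0
    simp only [zero_div, neg_zero, Real.rpow_zero] at this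
    exact this.mono_left nhdsWithin_le_nhds
  refine absurd (le_of_tendsto hc ?_) (not_le.2 hR1)
  filter_upwards [self_mem_nhdsWithin,
    eventually_nhdsWithin_of_eventually_nhds (Iic_mem_nhds one_pos)] with θ h0 h1
  exact key θ h0 h1

/-! ### Vector states and invariant means. -/

section Amenable

variable {G : Type*}

theorem norm_mul_apply_le (φ : lp (fun _ : G => ℂ) ∞) (ξ : lp (fun _ : G => ℂ) 2) (x : G) :
    ‖φ x * ξ x‖ ≤ ‖((‖φ‖ : ℂ) • ξ) x‖ := by
  rw [lp.coeFn_smul, Pi.smul_apply, norm_mul, norm_smul, Complex.norm_real, norm_norm]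
  exact mul_le_mul_of_nonneg_right (lp.norm_apply_le_norm ENNReal.top_ne_zero φ x) (norm_nonneg _)

/-- Multiplication by a bounded function on `ℓ²(G)`. -/
def mulL2 (φ : lp (fun _ : G => ℂ) ∞) : lp (fun _ : G => ℂ) 2 →L[ℂ] lp (fun _ : G => ℂ) 2 :=
  LinearMap.mkContinuous
    { toFun := fun ξ => ⟨fun x => φ x * ξ x,
        (lp.memℓp ((‖φ‖ : ℂ) • ξ)).mono' (norm_mul_apply_le φ ξ)⟩
      map_add' := fun _ _ => by ext x; exact mul_add _ _ _
      map_smul' := fun c _ => by ext x; exact mul_left_comm _ c _ } ‖φ‖ fun ξ => by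
    have h : ‖(‖φ‖ : ℂ) • ξ‖ = ‖φ‖ * ‖ξ‖ := by
      rw [norm_smul, Complex.norm_real, norm_norm]
    rw [← h]
    exact lp.norm_mono two_ne_zero (norm_mul_apply_le φ ξ)

@[simp] theorem mulL2_apply (φ : lp (fun _ : G => ℂ) ∞) (ξ : lp (fun _ : G => ℂ) 2) (x : G) :
    mulL2 φ ξ x = φ x * ξ x := rfl

theorem norm_mulL2_le (φ : lp (fun _ : G => ℂ) ∞) : ‖mulL2 φ‖ ≤ ‖φ‖ :=
  LinearMap.mkContinuous_norm_le _ (norm_nonneg _) _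

/-- The functional `φ ↦ ∑ x, ‖ξ x‖ ^ 2 * φ x` on `ℓ^∞(G)`. -/
def vectorState (ξ : lp (fun _ : G => ℂ) 2) : lp (fun _ : G => ℂ) ∞ →L[ℂ] ℂ :=
  LinearMap.mkContinuous
    { toFun := fun φ => inner ℂ ξ (mulL2 φ ξ)
      map_add' := fun φ ψ => by
        rw [← inner_add_right]
        congr 1
        ext x
        exact add_mul (φ x) (ψ x) (ξ x)
      map_smul' := fun c φ => by
        rw [RingHom.id_apply, smul_eq_mul, ← inner_smul_right]
        congr 1
        ext x
        exact mul_assoc c (φ x) (ξ x) } (‖ξ‖ ^ 2) fun φ => by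
    refine (norm_inner_le_norm (𝕜 := ℂ) ξ (mulL2 φ ξ)).trans ?_
    rw [sq, mul_assoc]
    refine mul_le_mul_of_nonneg_left ?_ (norm_nonneg _)
    rw [mul_comm]
    exact ((mulL2 φ).le_opNorm ξ).trans
      (mul_le_mul_of_nonneg_right (norm_mulL2_le φ) (norm_nonneg ξ))

theorem vectorState_apply (ξ : lp (fun _ : G => ℂ) 2) (φ : lp (fun _ : G => ℂ) ∞) :
    vectorState ξ φ = inner ℂ ξ (mulL2 φ ξ) := rfl

theorem norm_vectorState_le (ξ : lp (fun _ : G => ℂ) 2) : ‖vectorState ξ‖ ≤ ‖ξ‖ ^ 2 :=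
  LinearMap.mkContinuous_norm_le _ (sq_nonneg _) _

theorem vectorState_one (ξ : lp (fun _ : G => ℂ) 2) : vectorState ξ 1 = (‖ξ‖ : ℂ) ^ 2 := by
  refine Eq.trans ?_ (inner_self_eq_norm_sq_to_K (𝕜 := ℂ) ξ)
  rw [vectorState_apply]
  congr 1
  ext x
  exact one_mul _

open scoped ComplexOrder in
theorem vectorState_nonneg (ξ : lp (fun _ : G => ℂ) 2) {φ : lp (fun _ : G => ℂ) ∞}
    (hφ : ∀ y, 0 ≤ φ y) : 0 ≤ vectorState ξ φ := by
  rw [vectorState_apply, lp.inner_eq_tsum]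
  refine tsum_nonneg fun x => ?_
  rw [mulL2_apply, RCLike.inner_apply, mul_assoc]
  refine mul_nonneg (hφ x) ?_
  rw [Complex.mul_conj]
  exact_mod_cast Complex.normSq_nonneg _

theorem norm_vectorState_sub_le {ξ η : lp (fun _ : G => ℂ) 2} (hξ : ‖ξ‖ = 1) (hη : ‖η‖ = 1)
    (φ : lp (fun _ : G => ℂ) ∞) :
    ‖vectorState ξ φ - vectorState η φ‖ ≤ 2 * ‖φ‖ * ‖ξ - η‖ := by
  have h : vectorState ξ φ - vectorState η φ =
      inner ℂ (ξ - η) (mulL2 φ ξ) + inner ℂ η (mulL2 φ (ξ - η)) := by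
    rw [vectorState_apply, vectorState_apply, map_sub, inner_sub_left, inner_sub_right]
    ring
  have hb : ∀ ζ, ‖mulL2 φ ζ‖ ≤ ‖φ‖ * ‖ζ‖ := fun ζ => ((mulL2 φ).le_opNorm ζ).trans
    (mul_le_mul_of_nonneg_right (norm_mulL2_le φ) (norm_nonneg _))
  have h1 := (norm_inner_le_norm (𝕜 := ℂ) (ξ - η) (mulL2 φ ξ)).trans
    (mul_le_mul_of_nonneg_left (hb ξ) (norm_nonneg _))
  have h2 := (norm_inner_le_norm (𝕜 := ℂ) η (mulL2 φ (ξ - η))).trans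
    (mul_le_mul_of_nonneg_left (hb (ξ - η)) (norm_nonneg _))
  rw [hξ] at h1
  rw [hη] at h2
  rw [h]
  refine (norm_add_le _ _).trans ((add_le_add h1 h2).trans (le_of_eq ?_))
  ring

variable [Group G]

/-- Translation is isometric and intertwines multiplication by `φ` with multiplication by its
translate. -/
theorem vectorState_leftTranslate (s : G) (ξ : lp (fun _ : G => ℂ) 2)
    (φ : lp (fun _ : G => ℂ) ∞) :
    vectorState (leftRegular s ξ) (leftTranslate s φ) = vectorState ξ φ := by
  rw [vectorState_apply, vectorState_apply, ← (leftRegular s).inner_map_map ξ]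
  rfl

open scoped ComplexOrder in
/-- A group with almost invariant unit vectors in `ℓ²(G)` is amenable. -/
theorem isAmenableGroup_of_almost_invariant
    (h : ∀ (S : Finset G) (ε : ℝ), 0 < ε → ∃ ξ : lp (fun _ : G => ℂ) 2, ‖ξ‖ = 1 ∧
      ∀ s ∈ S, ‖leftRegular s ξ - ξ‖ ≤ ε) : IsAmenableGroup G := by
  classical
  choose! ξ hξ1 hξ using fun (i : Finset G × ℕ) => h i.1 (1 / ((i.2 : ℝ) + 1)) (by positivity)
  let F : Ultrafilter (Finset G × ℕ) := Ultrafilter.of atTop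
  have hF : (F : Filter (Finset G × ℕ)) ≤ atTop := Ultrafilter.of_le _
  let u : Finset G × ℕ → WeakDual ℂ (lp (fun _ : G => ℂ) ∞) := fun i =>
    StrongDual.toWeakDual (vectorState (ξ i))
  -- Banach–Alaoglu: the vector states converge weak-* along the ultrafilter.
  obtain ⟨m, -, hm⟩ := (WeakDual.isCompact_closedBall (𝕜 := ℂ) (E := lp (fun _ : G => ℂ) ∞)
    (0 : StrongDual ℂ (lp (fun _ : G => ℂ) ∞)) 1).ultrafilter_le_nhds (F.map u) (by
      rw [le_principal_iff]
      refine Filter.mem_map.2 (univ_mem' fun i => ?_)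
      change vectorState (ξ i) ∈ Metric.closedBall _ _
      rw [mem_closedBall_zero_iff]
      refine (norm_vectorState_le _).trans ?_
      rw [hξ1, one_pow])
  have ht : ∀ φ, Tendsto (fun i => vectorState (ξ i) φ) F (𝓝 (m φ)) := fun φ =>
    ((WeakDual.eval_continuous φ).tendsto m).comp hm
  refine ⟨WeakDual.toStrongDual m, fun φ hφ => ?_, ?_, fun s φ => ?_⟩
  · exact ge_of_tendsto (ht φ) (Eventually.of_forall fun i => vectorState_nonneg _ hφ)
  · refine tendsto_nhds_unique (ht 1) ?_
    simp only [vectorState_one, hξ1, Complex.ofReal_one, one_pow]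
    exact tendsto_const_nhds
  · refine tendsto_nhds_unique (ht (leftTranslate s φ)) ((ht φ).congr_dist ?_)
    have hb : Tendsto (fun i : Finset G × ℕ => 2 * ‖leftTranslate s φ‖ * (1 / ((i.2 : ℝ) + 1))) F
        (𝓝 (2 * ‖leftTranslate s φ‖ * 0)) := by
      refine Tendsto.mono_left ?_ hF
      rw [← prod_atTop_atTop_eq]
      exact (tendsto_one_div_add_atTop_nhds_zero_nat.comp tendsto_snd).const_mul _
    rw [mul_zero] at hb
    refine squeeze_zero' (Eventually.of_forall fun _ => dist_nonneg) ?_ hb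
    filter_upwards [hF (eventually_ge_atTop (({s} : Finset G), 0))] with i hi
    -- Now the same function is tested against two nearby unit vectors.
    rw [← vectorState_leftTranslate s (ξ i) φ, dist_eq_norm]
    refine (norm_vectorState_sub_le (by rw [LinearIsometry.norm_map, hξ1]) (hξ1 i) _).trans ?_
    exact mul_le_mul_of_nonneg_left (hξ i s (hi.1 (Finset.mem_singleton_self s))) (by positivity)

end Amenable

/-! ### From Kesten's condition to almost invariant vectors. -/

open GroupL1

/-- If the average of the translates of a unit vector over a finite set containing `1` has norm close
to one, then the vector is almost fixed by these translations. -/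
theorem norm_leftRegular_sub_sq_le {G : Type*} [Group G] {S : Finset G} (h1 : 1 ∈ S) {s : G}
    (hs : s ∈ S) {ξ : lp (fun _ : G => ℂ) 2} (hξ : ‖ξ‖ = 1) {δ : ℝ} (h0 : 0 ≤ δ)
    (hδ : 1 - δ ≤ ‖convL2 (uniform S) ξ‖) :
    ‖leftRegular s ξ - ξ‖ ^ 2 ≤ 4 * (S.card * δ) := by
  classical
  rcases eq_or_ne s 1 with rfl | hs1
  · rw [leftRegular_one, sub_self, norm_zero, zero_pow two_ne_zero]
    positivity
  have hcard : (0 : ℝ) < S.card := Nat.cast_pos.2 (Finset.card_pos.2 ⟨1, h1⟩)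
  have hsum : S.card * (1 - δ) ≤ ‖∑ t ∈ S, leftRegular t ξ‖ := by
    rw [convL2_uniform, norm_smul, norm_inv, Complex.norm_natCast, inv_mul_eq_div,
      le_div_iff₀ hcard] at hδ
    linarith
  have hs' : s ∈ S.erase 1 := Finset.mem_erase.2 ⟨hs1, hs⟩
  -- The other unit vectors contribute at most `|S| - 2`, so `ξ` and its translate must nearly add
  -- up in norm.
  have hrest : ‖∑ t ∈ (S.erase 1).erase s, leftRegular t ξ‖ ≤ S.card - 2 := by
    refine (norm_sum_le _ _).trans (le_of_eq ?_)
    rw [Finset.sum_congr rfl fun t _ => ((leftRegular t).norm_map ξ).trans hξ, Finset.sum_const,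
      nsmul_one, ← Finset.card_erase_add_one h1, ← Finset.card_erase_add_one hs']
    push_cast
    ring
  rw [← Finset.add_sum_erase _ _ h1, ← Finset.add_sum_erase _ _ hs', ← add_assoc,
    leftRegular_one] at hsum
  have h2 : 2 - S.card * δ ≤ ‖leftRegular s ξ + ξ‖ := by
    have := norm_add_le (ξ + leftRegular s ξ) (∑ t ∈ (S.erase 1).erase s, leftRegular t ξ)
    rw [add_comm ξ] at this hsum
    linarith
  have hpar := parallelogram_law_with_norm ℂ (leftRegular s ξ) ξ
  rw [(leftRegular s).norm_map, hξ] at hpar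
  have hnn := norm_nonneg (leftRegular s ξ + ξ)
  -- The lower bound `2 - |S| * δ` can be squared only if it is nonnegative; otherwise the trivial
  -- bound `4` suffices.
  rcases le_total (S.card * δ) 2 with h | h
  · nlinarith [mul_nonneg hcard.le h0]
  · nlinarith

theorem isAmenableGroup_of_one_le_norm_convL2 {G : Type*} [Group G]
    (h : ∀ S : Finset G, S.Nonempty → (∀ x ∈ S, x⁻¹ ∈ S) → 1 ≤ ‖convL2 (uniform S)‖) :
    IsAmenableGroup G := by
  classical
  refine isAmenableGroup_of_almost_invariant fun S ε hε => ?_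
  set S' : Finset G := insert 1 (S ∪ S⁻¹) with hS'
  have h1 : 1 ∈ S' := Finset.mem_insert_self _ _
  have hinv : ∀ x ∈ S', x⁻¹ ∈ S' := by
    intro x hx
    simp only [hS', Finset.mem_insert, Finset.mem_union, Finset.mem_inv', inv_eq_one, inv_inv]
      at hx ⊢
    tauto
  have hcard : (0 : ℝ) < S'.card := Nat.cast_pos.2 (Finset.card_pos.2 ⟨1, h1⟩)
  -- The second entry makes the final bound `ε ^ 2`; the `1` keeps `1 - δ` nonnegative, as a bound
  -- on an operator norm must be.
  set δ : ℝ := min 1 (ε ^ 2 / (4 * S'.card)) with hδ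
  have hδ0 : 0 < δ := lt_min one_pos (by positivity)
  have hlt : 1 - δ < ‖convL2 (uniform S')‖ := by linarith [h S' ⟨1, h1⟩ hinv]
  obtain ⟨η, hη⟩ : ∃ η, (1 - δ) * ‖η‖ < ‖convL2 (uniform S') η‖ := by
    by_contra! hc
    exact absurd (ContinuousLinearMap.opNorm_le_bound _
      (by linarith [min_le_left 1 (ε ^ 2 / (4 * S'.card))]) hc) (not_le.2 hlt)
  have hη0 : η ≠ 0 := by
    rintro rfl
    simp at hη
  have hηn : 0 < ‖η‖ := norm_pos_iff.2 hη0
  have hξ : ‖((‖η‖ : ℂ)⁻¹) • η‖ = 1 := by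
    rw [norm_smul, norm_inv, Complex.norm_real, norm_norm, inv_mul_cancel₀ hηn.ne']
  refine ⟨((‖η‖ : ℂ)⁻¹) • η, hξ, fun s hs => ?_⟩
  have hb : 1 - δ ≤ ‖convL2 (uniform S') (((‖η‖ : ℂ)⁻¹) • η)‖ := by
    rw [map_smul, norm_smul, norm_inv, Complex.norm_real, norm_norm, inv_mul_eq_div,
      le_div_iff₀ hηn]
    exact hη.le
  have hmain := norm_leftRegular_sub_sq_le h1
    (Finset.mem_insert_of_mem (Finset.mem_union_left _ hs)) hξ hδ0.le hb
  refine le_of_sq_le_sq (hmain.trans ?_) hε.le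
  have h4 : δ ≤ ε ^ 2 / (4 * S'.card) := min_le_right _ _
  rw [le_div_iff₀ (by positivity)] at h4
  linarith

end

theorem mainTheorem2 (G : Type*) [Group G] (hG : IsQuasiHermitianGroup G) :
    IsAmenableGroup G :=
  isAmenableGroup_of_one_le_norm_convL2 fun _ hS hS' => hG.one_le_norm_convL2_uniform hS hS'
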